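/- Let $H(\mathbb{C})$ be the space of entire functions endowed with the topology of local uniform convergence. For $b\in\mathbb{C}$ let $T_b:H(\mathbb{C})\to H(\mathbb{C})$ be the translation operator $T_b(f)(z)=f(z+b)$, and for a sequence $(T_n)_{n\ge 1}$ of continuous linear operators on $H(\mathbb{C})$ let $HC(\{T_n\})$ be the set of all $f\in H(\mathbb{C})$ such that $\{T_n(f):n\ge 1\}$ is dense in $H(\mathbb{C})$. Let $(\lambda_n)_{n\ge1}$ be a sequence of non-zero complex numbers with $|\lambda_n|\to+\infty$ that satisfies the following condition $(\Sigma)$: for every real $M>0$ there exists a subsequence $(\mu_n)$ of $(\lambda_n)$ such that (i) $|\mu_{n+1}|-|\mu_n|>M$ for every $n=1,2,\ldots$, and (ii) $\sum_{n=1}^{\infty}\frac{1}{|\mu_n|}=+\infty$. Then $$\bigcap_{a\in\mathbb{C}\setminus\{0\}}HC(\{T_{\lambda_n a}\})$$ is a $G_\delta$ and dense subset of $H(\mathbb{C})$. -/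

import Mathlib

open Filter Topology

/-- The space `H(ℂ)` of entire functions, as a linear subspace of `C(ℂ, ℂ)`. It carries the subspace
topology of the compact-open topology, which is the topology of locally uniform convergence. -/
def EntireSpace : Submodule ℂ C(ℂ, ℂ) where
  carrier := {f | Differentiable ℂ (f : ℂ → ℂ)}
  add_mem' := fun hf hg => Differentiable.add hf hg
  zero_mem' := differentiable_const (0 : ℂ)
  smul_mem' := fun c _ hf => Differentiable.const_smul hf c

/-- The translation operator `T_a : H(ℂ) → H(ℂ)`, `T_a(f)(z) = f(z + a)`, as a continuous linear
operator. -/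
noncomputable def translationOp (a : ℂ) : EntireSpace →L[ℂ] EntireSpace where
  toFun f := ⟨⟨fun z => f.1 (z + a), f.1.continuous.comp (continuous_id.add continuous_const)⟩,
    Differentiable.comp (g := (f.1 : ℂ → ℂ)) f.2 (differentiable_id.add_const a)⟩
  map_add' _ _ := rfl
  map_smul' _ _ := rfl
  cont := Continuous.subtype_mk
    ((ContinuousMap.continuous_precomp
      (⟨fun z => z + a, continuous_id.add continuous_const⟩ : C(ℂ, ℂ))).comp
        continuous_subtype_val) _

/-- `HC({T_n})`: the set of hypercyclic vectors of a sequence of continuous linear operators `T_n`,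
that is, of the vectors `x` for which `{T_n x : n}` is dense in the space. -/
def hypercyclicVectors {X : Type*} [AddCommMonoid X] [Module ℂ X] [TopologicalSpace X]
    (T : ℕ → X →L[ℂ] X) : Set X :=
  {x | Dense (Set.range fun n => T n x)}

/-- Condition `(Σ)`: for every `M > 0` there is a subsequence `(μ_n)` of `(lam_n)` with
`|μ_{n+1}| - |μ_n| > M` for all `n` and `∑ 1 / |μ_n| = +∞` (the partial sums tend to `+∞`). -/
def ConditionSigma (lam : ℕ → ℂ) : Prop :=
  ∀ M : ℝ, 0 < M → ∃ k : ℕ → ℕ, StrictMono k ∧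
    (∀ n, M < ‖lam (k (n + 1))‖ - ‖lam (k n)‖) ∧
    Tendsto (fun N => ∑ n ∈ Finset.range N, 1 / ‖lam (k n)‖) atTop atTop

/-!
By Baire's theorem it is enough to find, for a compact set `K` of non-zero parameters and non-empty
open sets `U` and `V` of entire functions, some `f ∈ V` such that every `a ∈ K` has an `n` with
`T_{λ_n a} f ∈ U`. If finitely many points `w` are far from each other and from `0`, Runge's theorem
yields a polynomial `f` that is near a given `g ∈ V` around `0` and near a translate of a given
`h ∈ U` around each `w`; then `T_b f ∈ U` whenever `b` is close enough to one of the `w`. So the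
points `w` only need to form a separated set that comes close to some `λ_n a` for every `a ∈ K`.

Condition `(Σ)` supplies such a set. Restrict to a subsequence with large gaps and split it into
blocks of fixed length `N`. Blocks along which `|λ_n|` more than doubles contribute a finite amount
to `∑ 1 / |λ_n|`, so the rings of width comparable to `1 / |λ_n|` attached to the other blocks
exhaust any annulus. Points of a ring at scale `δ / |λ_n|` fall into `N` classes that are separated
at scale `M / |λ_n|`, and the `i`-th term of the block is multiplied with the `i`-th class. Products
coming from different terms are far apart because of the gaps: the radii of the rings increase, and
within one ring they vary too little to compensate for a gap.

Runge's theorem is obtained from the resolvent of the coordinate function in the algebra of uniform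
limits of polynomials on a compact set with connected complement: the spectrum does not change when
passing to that algebra, so Cauchy kernels lie in it.
-/

section Connectedness

open Metric

theorem isPreconnected_sdiff_of_isClosed_subset_isOpen {X : Type*} [TopologicalSpace X]
    {U B C : Set X} (hU : IsPreconnected U) (hB : IsOpen B) (hC : IsClosed C) (hCB : C ⊆ B)
    (hBU : B ⊆ U) (hBC : IsPreconnected (B \ C)) : IsPreconnected (U \ C) := by
  classical
  refine isPreconnected_of_forall_constant fun f hf x hx y hy => ?_
  obtain ⟨b, hb⟩ : ∃ b, ∀ z ∈ B \ C, f z = b := by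
    rcases (B \ C).eq_empty_or_nonempty with h | ⟨z, hz⟩
    · exact ⟨true, by simp [h]⟩
    · exact ⟨f z, fun w hw => hBC.constant (hf.mono (Set.sdiff_subset_sdiff_left hBU)) hw hz⟩
  set g : X → Bool := B.piecewise (fun _ => b) f
  have hgf : Set.EqOn g f Cᶜ := fun z hz => by
    by_cases hzB : z ∈ B
    · simpa only [g, Set.piecewise_eq_of_mem _ _ _ hzB] using (hb z ⟨hzB, hz⟩).symm
    · exact Set.piecewise_eq_of_notMem _ _ _ hzB
  have hg : ContinuousOn g U := fun z hz => by
    by_cases hzB : z ∈ B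
    · have hgb : g =ᶠ[𝓝 z] fun _ => b := by
        filter_upwards [hB.mem_nhds hzB] with w hw using Set.piecewise_eq_of_mem _ _ _ hw
      exact (continuousAt_const.congr hgb.symm).continuousWithinAt
    · have hzC : Cᶜ ∈ 𝓝 z := hC.isOpen_compl.mem_nhds fun h => hzB (hCB h)
      refine (continuousWithinAt_inter hzC).1 ?_
      exact (hf z ⟨hz, mem_of_mem_nhds hzC⟩).congr (fun w hw => hgf hw.2)
        (hgf (mem_of_mem_nhds hzC))
  rw [← hgf hx.2, ← hgf hy.2]
  exact hU.constant hg hx.1 hy.1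

variable {E : Type*} [NormedAddCommGroup E] [NormedSpace ℝ E]

theorem isPreconnected_ball_sdiff_closedBall (hE : 1 < Module.rank ℝ E) (c : E) {r : ℝ}
    (hr : 0 ≤ r) (R : ℝ) : IsPreconnected (ball c R \ closedBall c r) := by
  have hpolar : ball c R \ closedBall c r =
      (fun p : ℝ × E => c + p.1 • p.2) '' (Set.Ioo r R ×ˢ sphere 0 1) := by
    ext z
    simp only [Set.mem_sdiff, mem_ball_iff_norm, mem_closedBall_iff_norm, not_le, Set.mem_image,
      Set.mem_prod, Set.mem_Ioo, mem_sphere_zero_iff_norm, Prod.exists]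
    constructor
    · rintro ⟨hzR, hzr⟩
      have hz : ‖z - c‖ ≠ 0 := (hr.trans_lt hzr).ne'
      exact ⟨‖z - c‖, ‖z - c‖⁻¹ • (z - c), ⟨⟨hzr, hzR⟩, by simp [norm_smul, hz]⟩,
        by rw [smul_inv_smul₀ hz, add_sub_cancel]⟩
    · rintro ⟨t, u, ⟨⟨hrt, htR⟩, hu⟩, rfl⟩
      rw [add_sub_cancel_left, norm_smul, hu, mul_one, Real.norm_of_nonneg (hr.trans hrt.le)]
      exact ⟨htR, hrt⟩
  rw [hpolar]
  exact (isPreconnected_Ioo.prod (isPreconnected_sphere hE _ _)).image _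
    (by fun_prop : Continuous _).continuousOn

theorem isPreconnected_compl_biUnion_closedBall (hE : 1 < Module.rank ℝ E) {ι : Type*}
    (s : Finset ι) {c : ι → E} {r R : ι → ℝ} (hr : ∀ i ∈ s, 0 ≤ r i) (hrR : ∀ i ∈ s, r i < R i)
    (hdisj : (s : Set ι).PairwiseDisjoint fun i => closedBall (c i) (R i)) :
    IsPreconnected (⋃ i ∈ s, closedBall (c i) (r i))ᶜ := by
  classical
  induction s using Finset.induction_on with
  | empty => simpa using isPreconnected_univ
  | insert a s ha ih =>
    rw [Finset.forall_mem_insert] at hr hrR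
    rw [Finset.coe_insert] at hdisj
    rw [Finset.set_biUnion_insert, Set.compl_union, Set.inter_comm, ← Set.sdiff_eq]
    refine isPreconnected_sdiff_of_isClosed_subset_isOpen
      (ih hr.2 hrR.2 (hdisj.subset (Set.subset_insert _ _))) isOpen_ball isClosed_closedBall
      (closedBall_subset_ball hrR.1) ?_ (isPreconnected_ball_sdiff_closedBall hE _ hr.1 _)
    refine Set.subset_compl_iff_disjoint_right.2 (Set.disjoint_iUnion₂_right.2 fun i hi => ?_)
    exact (hdisj (Set.mem_insert _ _) (Set.mem_insert_of_mem _ hi)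
      (ne_of_mem_of_not_mem hi ha).symm).mono ball_subset_closedBall
        (closedBall_subset_closedBall (hrR.2 i hi).le)

end Connectedness

section Runge

open Metric

/-- The algebra `P(K)` of uniform limits of polynomials on a compact set `K ⊆ ℂ`, the Banach algebra
in which the resolvent argument for Runge's theorem takes place. -/
noncomputable def uniformPolynomialAlgebra (K : Set ℂ) [CompactSpace K] : Subalgebra ℂ C(K, ℂ) :=
  (polynomialFunctions K).topologicalClosure

variable {K : Set ℂ} [CompactSpace K]

noncomputable instance : CompleteSpace (uniformPolynomialAlgebra K) :=
  (Subalgebra.isClosed_topologicalClosure _).completeSpace_coe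

theorem exists_polynomial_near_of_mem_uniformPolynomialAlgebra {g : C(K, ℂ)}
    (hg : g ∈ uniformPolynomialAlgebra K) {ε : ℝ} (hε : 0 < ε) :
    ∃ p : Polynomial ℂ, ∀ z : K, ‖p.eval (z : ℂ) - g z‖ < ε := by
  obtain ⟨_, ⟨p, -, rfl⟩, hp⟩ := Metric.mem_closure_iff.1 hg ε hε
  refine ⟨p, fun z => ?_⟩
  simpa [dist_eq_norm_sub'] using (ContinuousMap.dist_lt_iff hε).1 hp z

variable (K) in
/-- The coordinate function `z ↦ z` as an element of `P(K)`. Its resolvent is the Cauchy kernel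
`ζ ↦ (z ↦ (ζ - z)⁻¹)` with values in `P(K)`. -/
noncomputable def uniformPolynomialAlgebra.coord : uniformPolynomialAlgebra K :=
  ⟨Polynomial.X.toContinuousMapOn K,
    Subalgebra.le_topologicalClosure _ ⟨Polynomial.X, trivial, rfl⟩⟩

namespace uniformPolynomialAlgebra

theorem coord_apply (z : K) : (coord K : C(K, ℂ)) z = z := by
  simp [coord]

theorem spectrum_coord (hK : IsPreconnected Kᶜ) : spectrum ℂ (coord K) = K := by
  have hspec : spectrum ℂ (coord K : C(K, ℂ)) = K := by
    rw [ContinuousMap.spectrum_eq_range, funext coord_apply, Subtype.range_coe]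
  have : IsClosed (uniformPolynomialAlgebra K : Set C(K, ℂ)) :=
    Subalgebra.isClosed_topologicalClosure _
  rw [Subalgebra.spectrum_eq_of_isPreconnected_compl _ _ (by rwa [hspec]), hspec]

theorem resolvent_coord_apply (hK : IsPreconnected Kᶜ) {ζ : ℂ} (hζ : ζ ∉ K) (z : K) :
    ((resolvent (coord K) ζ : uniformPolynomialAlgebra K) : C(K, ℂ)) z = (ζ - z)⁻¹ := by
  rw [← spectrum_coord hK] at hζ
  have hinv := congrArg (fun g : uniformPolynomialAlgebra K => (g : C(K, ℂ)) z)
    (Ring.mul_inverse_cancel _ (spectrum.notMem_iff.1 hζ))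
  refine eq_inv_of_mul_eq_one_right ?_
  rw [← coord_apply z]
  exact hinv

theorem continuousOn_resolvent_coord (hK : IsPreconnected Kᶜ) :
    ContinuousOn (resolvent (coord K)) Kᶜ := fun ζ hζ => by
  rw [← spectrum_coord hK] at hζ
  exact (spectrum.hasDerivAt_resolvent_const_left
    (Set.notMem_compl_iff.1 hζ)).continuousAt.continuousWithinAt

theorem circleIntegral_smul_resolvent_coord_apply (hK : IsPreconnected Kᶜ) {c : ℂ} {R : ℝ}
    (hR : 0 ≤ R) (hcK : Disjoint (sphere c R) K) {F : ℂ → ℂ} (hF : ContinuousOn F (sphere c R))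
    (z : K) :
    ((∮ ζ in C(c, R), F ζ • resolvent (coord K) ζ : uniformPolynomialAlgebra K) : C(K, ℂ)) z =
      ∮ ζ in C(c, R), (ζ - z)⁻¹ • F ζ := by
  let ev : uniformPolynomialAlgebra K →L[ℂ] ℂ :=
    (ContinuousMap.evalCLM ℂ z).comp (uniformPolynomialAlgebra K).toSubmodule.subtypeL
  have hcirc : CircleIntegrable (fun ζ => F ζ • resolvent (coord K) ζ) c R :=
    (hF.smul ((continuousOn_resolvent_coord hK).mono
      hcK.subset_compl_right)).circleIntegrable hR
  change ev (∮ ζ in C(c, R), F ζ • resolvent (coord K) ζ) = _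
  rw [circleIntegral, ← ContinuousLinearMap.intervalIntegral_comp_comm _ hcirc.out, circleIntegral]
  refine intervalIntegral.integral_congr fun θ _ => ?_
  have hθ : ev (resolvent (coord K) (circleMap c R θ)) = (circleMap c R θ - z)⁻¹ :=
    resolvent_coord_apply hK (hcK.notMem_of_mem_left (circleMap_mem_sphere c hR θ)) z
  simp only [map_smul, hθ, smul_eq_mul]
  ring

/-- Cauchy's formula over `|ζ - c| = R` reproduces `F` inside the circle and `0` outside. -/
theorem exists_mem_eq_of_mem_ball (hK : IsPreconnected Kᶜ) {c : ℂ} {R : ℝ} (hR : 0 ≤ R)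
    (hcK : Disjoint (sphere c R) K) {F : ℂ → ℂ} (hF : DiffContOnCl ℂ F (ball c R)) :
    ∃ g ∈ uniformPolynomialAlgebra K, ∀ z : K,
      ((z : ℂ) ∈ ball c R → g z = F z) ∧ ((z : ℂ) ∉ closedBall c R → g z = 0) := by
  have hFsphere : ContinuousOn F (sphere c R) :=
    hF.continuousOn_ball.mono sphere_subset_closedBall
  have hval := circleIntegral_smul_resolvent_coord_apply hK hR hcK hFsphere
  refine ⟨_, ((2 * Real.pi * Complex.I : ℂ)⁻¹ •
    ∮ ζ in C(c, R), F ζ • resolvent (coord K) ζ : uniformPolynomialAlgebra K).2,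
    fun z => ⟨fun hz => ?_, fun hz => ?_⟩⟩
  · rw [Subalgebra.coe_smul, ContinuousMap.smul_apply, hval]
    exact hF.two_pi_i_inv_smul_circleIntegral_sub_inv_smul hz
  · have hne : ∀ ζ ∈ closure (ball c R), ζ - (z : ℂ) ≠ 0 := fun ζ hζ h =>
      hz (sub_eq_zero.1 h ▸ closure_ball_subset_closedBall hζ)
    have hdiff : DiffContOnCl ℂ (fun ζ => (ζ - (z : ℂ))⁻¹ • F ζ) (ball c R) :=
      ((Differentiable.diffContOnCl (by fun_prop)).inv hne).smul hF
    rw [Subalgebra.coe_smul, ContinuousMap.smul_apply, hval, hdiff.circleIntegral_eq_zero hR,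
      smul_zero]

end uniformPolynomialAlgebra

theorem exists_polynomial_near_of_pairwiseDisjoint_closedBall {ι : Type*} (s : Finset ι)
    {c : ι → ℂ} {r R : ι → ℝ} (hr : ∀ i ∈ s, 0 ≤ r i) (hrR : ∀ i ∈ s, r i < R i)
    (hdisj : (s : Set ι).PairwiseDisjoint fun i => closedBall (c i) (R i))
    {F : ι → ℂ → ℂ} (hF : ∀ i ∈ s, DiffContOnCl ℂ (F i) (ball (c i) (R i))) {ε : ℝ} (hε : 0 < ε) :
    ∃ p : Polynomial ℂ, ∀ i ∈ s, ∀ z ∈ closedBall (c i) (r i), ‖p.eval z - F i z‖ < ε := by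
  set K : Set ℂ := ⋃ i ∈ s, closedBall (c i) (r i)
  have : CompactSpace K := isCompact_iff_compactSpace.1
    (s.isCompact_biUnion fun i _ => isCompact_closedBall (c i) (r i))
  have hK : IsPreconnected Kᶜ :=
    isPreconnected_compl_biUnion_closedBall (by simp) s hr hrR hdisj
  have hsmall : ∀ i ∈ s, closedBall (c i) (r i) ⊆ ball (c i) (R i) := fun i hi =>
    closedBall_subset_ball (hrR i hi)
  have hsphere : ∀ i ∈ s, Disjoint (sphere (c i) (R i)) K := fun i hi =>
    Set.disjoint_iUnion₂_right.2 fun j hj => by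
      rcases eq_or_ne i j with rfl | hij
      · exact sphere_disjoint_ball.mono_right (hsmall i hi)
      · exact (hdisj hi hj hij).mono sphere_subset_closedBall
          ((hsmall j hj).trans ball_subset_closedBall)
  have hcauchy : ∀ i ∈ s, ∃ g ∈ uniformPolynomialAlgebra K, ∀ z : K,
      ((z : ℂ) ∈ ball (c i) (R i) → g z = F i z) ∧ ((z : ℂ) ∉ closedBall (c i) (R i) → g z = 0) :=
    fun i hi => uniformPolynomialAlgebra.exists_mem_eq_of_mem_ball hK
      ((hr i hi).trans (hrR i hi).le) (hsphere i hi) (hF i hi)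
  choose! g hgmem hg using hcauchy
  obtain ⟨p, hp⟩ := exists_polynomial_near_of_mem_uniformPolynomialAlgebra
    (sum_mem hgmem : ∑ i ∈ s, g i ∈ uniformPolynomialAlgebra K) hε
  refine ⟨p, fun i hi z hz => ?_⟩
  have hsum : (∑ j ∈ s, g j) ⟨z, Set.mem_biUnion hi hz⟩ = F i z := by
    rw [ContinuousMap.sum_apply, Finset.sum_eq_single_of_mem i hi fun j hj hji =>
      (hg j hj _).2 ((hdisj hi hj hji.symm).notMem_of_mem_left
        (ball_subset_closedBall (hsmall i hi hz)))]
    exact (hg i hi _).1 (hsmall i hi hz)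
  simpa only [hsum] using hp ⟨z, Set.mem_biUnion hi hz⟩

theorem exists_polynomial_near_and_near_translates {g h : ℂ → ℂ} (hg : Differentiable ℂ g)
    (hh : Differentiable ℂ h) {r R ε : ℝ} (hr : 0 ≤ r) (hrR : 2 * r < R) (hε : 0 < ε)
    {W : Finset ℂ} (h0 : 0 ∉ W)
    (hW : (insert 0 W : Set ℂ).Pairwise fun w w' => R ≤ dist w w') :
    ∃ p : Polynomial ℂ, (∀ z ∈ closedBall 0 r, ‖p.eval z - g z‖ < ε) ∧
      ∀ w ∈ W, ∀ z ∈ closedBall 0 r, ‖p.eval (z + w) - h z‖ < ε := by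
  classical
  obtain ⟨t, hrt, htR⟩ := exists_between (show r < R / 2 by linarith)
  have hdisj : ((insert 0 W : Finset ℂ) : Set ℂ).PairwiseDisjoint fun w => closedBall w t := by
    rw [Finset.coe_insert]
    exact hW.imp fun w w' hww' => closedBall_disjoint_closedBall (by linarith)
  obtain ⟨p, hp⟩ := exists_polynomial_near_of_pairwiseDisjoint_closedBall (insert 0 W)
    (c := id) (r := fun _ => r) (R := fun _ => t) (fun _ _ => hr) (fun _ _ => hrt) hdisj
    (F := Function.update (fun w z => h (z - w)) 0 g) (fun w _ => by
      rcases eq_or_ne w 0 with rfl | hw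
      · rw [Function.update_self]
        exact hg.diffContOnCl
      · rw [Function.update_of_ne hw]
        exact (hh.comp (differentiable_id.sub_const w)).diffContOnCl) hε
  refine ⟨p, fun z hz => ?_, fun w hw z hz => ?_⟩
  · simpa only [Function.update_self] using hp 0 (Finset.mem_insert_self _ _) z hz
  · have hzw : z + w ∈ closedBall w r := by simpa using hz
    simpa only [Function.update_of_ne (ne_of_mem_of_not_mem hw h0), add_sub_cancel_right] using
      hp w (Finset.mem_insert_of_mem hw) (z + w) hzw

end Runge

section SeparatedNets

/-- The index of the square of side `s` of the grid `s • ℤ[i]` that contains the point `a`. It is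
used to discretise bounded subsets of the plane at scale `s`. -/
noncomputable def gridCell (s : ℝ) (a : ℂ) : ℤ × ℤ :=
  (⌊a.re / s⌋, ⌊a.im / s⌋)

theorem dist_lt_of_gridCell_eq {s : ℝ} (hs : 0 < s) {a b : ℂ} (h : gridCell s a = gridCell s b) :
    dist a b < 2 * s := by
  have hcoord : ∀ {u v : ℝ}, ⌊u / s⌋ = ⌊v / s⌋ → |u - v| < s := fun huv => by
    have := Int.abs_sub_lt_one_of_floor_eq_floor huv
    rwa [← sub_div, abs_div, abs_of_pos hs, div_lt_one hs] at this
  have hre := hcoord (congrArg Prod.fst h)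
  have him := hcoord (congrArg Prod.snd h)
  calc dist a b ≤ |a.re - b.re| + |a.im - b.im| := by
        simpa only [dist_eq_norm, Complex.sub_re, Complex.sub_im] using
          Complex.norm_le_abs_re_add_abs_im (a - b)
    _ < 2 * s := by linarith

theorem sub_one_le_abs_sub_of_floor_ne {q : ℕ} {u v : ℝ} (hne : ⌊u⌋ ≠ ⌊v⌋)
    (hmod : (⌊u⌋ : ZMod q) = ⌊v⌋) : (q : ℝ) - 1 ≤ |u - v| := by
  have hq : (q : ℤ) ≤ |⌊v⌋ - ⌊u⌋| := Int.le_of_dvd (abs_pos.2 (sub_ne_zero.2 hne.symm))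
    ((dvd_abs _ _).2 ((ZMod.intCast_eq_intCast_iff_dvd_sub _ _ _).1 hmod))
  have hq' : (q : ℝ) ≤ |(⌊v⌋ : ℝ) - ⌊u⌋| := by exact_mod_cast hq
  have hu := Int.floor_le u
  have hu' := Int.lt_floor_add_one u
  have hv := Int.floor_le v
  have hv' := Int.lt_floor_add_one v
  rcases le_abs.1 hq' with h | h <;> rcases le_total u v with huv | huv <;>
    simp only [abs_of_nonneg, abs_of_nonpos, sub_nonneg, sub_nonpos, huv] <;> linarith

theorem le_dist_of_gridCell_ne {s : ℝ} (hs : 0 < s) {q : ℕ} {a b : ℂ}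
    (hne : gridCell s a ≠ gridCell s b)
    (hmod : (gridCell s a).map ((↑) : ℤ → ZMod q) ((↑) : ℤ → ZMod q) =
      (gridCell s b).map (↑) (↑)) :
    ((q : ℝ) - 1) * s ≤ dist a b := by
  have hcoord : ∀ {u v : ℝ}, ⌊u / s⌋ ≠ ⌊v / s⌋ → (⌊u / s⌋ : ZMod q) = ⌊v / s⌋ →
      ((q : ℝ) - 1) * s ≤ |u - v| := fun hne hmod => by
    have := sub_one_le_abs_sub_of_floor_ne hne hmod
    rwa [← sub_div, abs_div, abs_of_pos hs, le_div_iff₀ hs] at this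
  rw [dist_eq_norm]
  by_cases hre : ⌊a.re / s⌋ = ⌊b.re / s⌋
  · have him : ⌊a.im / s⌋ ≠ ⌊b.im / s⌋ := fun him => hne (Prod.ext hre him)
    exact (hcoord him (congrArg Prod.snd hmod)).trans (Complex.abs_im_le_norm (a - b))
  · exact (hcoord hre (congrArg Prod.fst hmod)).trans (Complex.abs_re_le_norm (a - b))

theorem finite_image_gridCell (s : ℝ) {A : Set ℂ} (hA : Bornology.IsBounded A) :
    (gridCell s '' A).Finite := by
  obtain ⟨C, hC⟩ := hA.exists_norm_le
  have hfloor : ∀ {u : ℝ}, |u| ≤ C → ⌊u / s⌋ ∈ Set.Icc ⌊-(C / |s|)⌋ ⌊C / |s|⌋ := fun {u} hu => by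
    have : |u / s| ≤ C / |s| := by
      rw [abs_div]
      gcongr
    exact ⟨Int.floor_mono (neg_le_of_abs_le this), Int.floor_mono (le_of_abs_le this)⟩
  let I := Set.Icc ⌊-(C / |s|)⌋ ⌊C / |s|⌋
  refine ((Set.finite_Icc _ _).prod (Set.finite_Icc _ _) : (I ×ˢ I).Finite).subset ?_
  rintro _ ⟨a, ha, rfl⟩
  exact ⟨hfloor ((Complex.abs_re_le_norm a).trans (hC a ha)),
    hfloor ((Complex.abs_im_le_norm a).trans (hC a ha))⟩

theorem exists_separated_cover (κ : ℝ) : ∃ N : ℕ, 0 < N ∧ ∀ s : ℝ, 0 < s → ∀ A : Set ℂ,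
    Bornology.IsBounded A → ∃ G : ℕ → Finset ℂ, (∀ i, (G i : Set ℂ) ⊆ A) ∧
      (∀ i, (G i : Set ℂ).Pairwise fun g g' => κ * s ≤ dist g g') ∧
      ∀ a ∈ A, ∃ i < N, ∃ g ∈ G i, dist a g < s := by
  classical
  obtain ⟨q, hq⟩ := exists_nat_ge (2 * κ)
  let color := Fintype.equivFin (ZMod (q + 1) × ZMod (q + 1))
  refine ⟨_, Fintype.card_pos_iff.2 ⟨(0 : ZMod (q + 1) × ZMod (q + 1))⟩, fun s hs A hA => ?_⟩
  -- One point of `A` in each grid square; squares are coloured by their indices modulo `q + 1`.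
  obtain ⟨B, hBA, hB⟩ := (Set.surjOn_image (gridCell (s / 2)) A).exists_bijOn_subset
  have hBfin : B.Finite :=
    Set.Finite.of_finite_image (hB.image_eq ▸ finite_image_gridCell _ hA) hB.injOn
  let c (b : ℂ) : ZMod (q + 1) × ZMod (q + 1) := (gridCell (s / 2) b).map (↑) (↑)
  refine ⟨fun i => {b ∈ hBfin.toFinset | (color (c b) : ℕ) = i}, fun i b hb => ?_,
    fun i b hb b' hb' hne => ?_, fun a ha => ?_⟩
  · exact hBA (hBfin.mem_toFinset.1 (Finset.mem_filter.1 hb).1)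
  · obtain ⟨hbB, hbi⟩ := Finset.mem_filter.1 hb
    obtain ⟨hbB', hbi'⟩ := Finset.mem_filter.1 hb'
    have hcell := hB.injOn.ne (hBfin.mem_toFinset.1 hbB) (hBfin.mem_toFinset.1 hbB') hne
    have hc : c b = c b' := color.injective (Fin.ext (hbi.trans hbi'.symm))
    have hdist := le_dist_of_gridCell_ne (half_pos hs) hcell hc
    push_cast at hdist
    nlinarith
  · obtain ⟨b, hb, hab⟩ := hB.surjOn (Set.mem_image_of_mem _ ha)
    refine ⟨color (c b), (color (c b)).isLt, b, by simp [hb], ?_⟩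
    simpa only [mul_div_cancel₀ s two_ne_zero] using dist_lt_of_gridCell_eq (half_pos hs) hab.symm

theorem not_summable_indicator_inv_succ {m : ℕ → ℝ} (hm : Monotone m) (hpos : ∀ j, 0 < m j)
    (hdiv : ¬ Summable fun j => (m j)⁻¹) :
    ¬ Summable ({j | m (j + 1) ≤ 2 * m j}.indicator fun j => (m (j + 1))⁻¹) := by
  set D : Set ℕ := {j | m (j + 1) ≤ 2 * m j}
  have hinv : ∀ j, (m (j + 1))⁻¹ ≤ (m j)⁻¹ := fun j => inv_anti₀ (hpos j) (hm j.le_succ)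
  have htel : Summable fun j => (m j)⁻¹ - (m (j + 1))⁻¹ :=
    summable_of_sum_range_le (c := (m 0)⁻¹) (fun j => sub_nonneg.2 (hinv j)) fun n => by
      rw [Finset.sum_range_sub', sub_le_self_iff]
      exact (inv_pos.2 (hpos n)).le
  -- Where `m` more than doubles, `1 / m (j + 1)` is at most the decrement of `1 / m`.
  have hle : ∀ j, (m (j + 1))⁻¹ ≤
      D.indicator (fun j => (m (j + 1))⁻¹) j + ((m j)⁻¹ - (m (j + 1))⁻¹) := fun j => by
    by_cases hj : j ∈ D
    · rw [Set.indicator_of_mem hj]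
      linarith [hinv j]
    · rw [Set.indicator_of_notMem hj]
      have : 2 * (m (j + 1))⁻¹ ≤ (m j)⁻¹ := by
        rw [← div_eq_mul_inv, div_le_iff₀ (hpos _), inv_mul_eq_div, le_div_iff₀ (hpos _)]
        exact (not_le.1 hj).le
      linarith
  exact fun hD => hdiv ((summable_nat_add_iff 1).1
    ((hD.add htel).of_nonneg_of_le (fun j => (inv_pos.2 (hpos _)).le) hle))

theorem exists_monotone_radii {m : ℕ → ℝ} (hm : Monotone m) (hpos : ∀ j, 0 < m j)
    (hdiv : ¬ Summable fun j => (m j)⁻¹) (r : ℝ) {M : ℝ} (hM : 0 < M) :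
    ∃ ρ : ℕ → ℝ, ρ 0 = r ∧ Monotone ρ ∧ Tendsto ρ atTop atTop ∧
      (∀ j, m (j + 1) * (ρ (j + 1) - ρ j) ≤ M) ∧ ∀ j, ρ j < ρ (j + 1) → m (j + 1) ≤ 2 * m j := by
  set D : Set ℕ := {j | m (j + 1) ≤ 2 * m j}
  set t : ℕ → ℝ := D.indicator fun j => (m (j + 1))⁻¹
  have ht : ∀ j, 0 ≤ t j := fun j => Set.indicator_nonneg (fun j _ => (inv_pos.2 (hpos _)).le) j
  let ρ (j : ℕ) : ℝ := r + M * ∑ i ∈ Finset.range j, t i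
  have hstep : ∀ j, ρ (j + 1) - ρ j = M * t j := fun j => by
    simp only [ρ, Finset.sum_range_succ]
    ring
  refine ⟨ρ, by simp [ρ], monotone_nat_of_le_succ fun j => ?_, ?_, fun j => ?_, fun j hj => ?_⟩
  · rw [← sub_nonneg, hstep]
    exact mul_nonneg hM.le (ht j)
  · exact tendsto_atTop_add_const_left _ _ (((not_summable_iff_tendsto_nat_atTop_of_nonneg ht).1
      (not_summable_indicator_inv_succ hm hpos hdiv)).const_mul_atTop hM)
  · have hmt : m (j + 1) * t j ≤ 1 := by
      rw [← mul_inv_cancel₀ (hpos (j + 1)).ne']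
      exact mul_le_mul_of_nonneg_left
        (Set.indicator_le_self' (fun j _ => (inv_pos.2 (hpos _)).le) j) (hpos _).le
    rw [hstep]
    nlinarith
  · rw [← sub_pos, hstep] at hj
    exact Set.mem_of_indicator_ne_zero (s := D) (pos_of_mul_pos_right hj hM.le).ne'

theorem not_summable_comp_mul_of_antitone {f : ℕ → ℝ} (hf : Antitone f) (hdiv : ¬ Summable f)
    {N : ℕ} (hN : 0 < N) : ¬ Summable fun j => f (N * j) := by
  have : NeZero N := ⟨hN.ne'⟩
  rwa [← summable_indicator_mod_iff hf ((0 : ℕ) : ZMod N),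
    summable_indicator_mod_iff_summable] at hdiv

theorem exists_rings_separated_cover {x : ℕ → ℝ} (hx : Monotone x) (hpos : ∀ n, 0 < x n)
    (hdiv : ¬ Summable fun n => (x n)⁻¹) (r : ℝ) {δ M : ℝ} (hδ : 0 < δ) (hM : 0 < M) :
    ∃ N : ℕ, 0 < N ∧ ∃ ρ : ℕ → ℝ, ρ 0 = r ∧ Monotone ρ ∧ Tendsto ρ atTop atTop ∧
      (∀ j, x (N * (j + 1)) * (ρ (j + 1) - ρ j) ≤ M) ∧
      ∀ j, ∃ G : ℕ → Finset ℂ, (∀ i, ∀ g ∈ G i, ‖g‖ ∈ Set.Ico (ρ j) (ρ (j + 1))) ∧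
        (∀ i, (G i : Set ℂ).Pairwise fun g g' => M ≤ x (N * j) * dist g g') ∧
        ∀ a : ℂ, ‖a‖ ∈ Set.Ico (ρ j) (ρ (j + 1)) →
          ∃ i < N, ∃ g ∈ G i, x (N * (j + 1)) * dist a g < δ := by
  obtain ⟨N, hN, hcover⟩ := exists_separated_cover (2 * M / δ)
  obtain ⟨ρ, hρr, hρ, hρtop, hwidth, hdouble⟩ := exists_monotone_radii (m := fun j => x (N * j))
    (fun i j hij => hx (Nat.mul_le_mul_left N hij)) (fun j => hpos _)
    (not_summable_comp_mul_of_antitone (fun i j hij => inv_anti₀ (hpos i) (hx hij)) hdiv hN)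
    r hM
  refine ⟨N, hN, ρ, hρr, hρ, hρtop, hwidth, fun j => ?_⟩
  have hxj := hpos (N * (j + 1))
  obtain ⟨G, hGA, hGsep, hGcov⟩ := hcover (δ / x (N * (j + 1))) (div_pos hδ hxj)
    {a | ‖a‖ ∈ Set.Ico (ρ j) (ρ (j + 1))} ((Metric.isBounded_ball (x := 0)
      (r := ρ (j + 1))).subset fun a ha => mem_ball_zero_iff.2 ha.2)
  refine ⟨G, hGA, fun i g hg g' hg' hne => ?_, fun a ha => ?_⟩
  · have hgA := hGA i hg
    have hxx := hdouble j (hgA.1.trans_lt hgA.2)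
    calc M = x (N * (j + 1)) / 2 * (2 * M / δ * (δ / x (N * (j + 1)))) := by field_simp
      _ ≤ x (N * j) * dist g g' := by
        refine mul_le_mul (by linarith) (hGsep i hg hg' hne) ?_ (hpos _).le
        positivity
  · obtain ⟨i, hi, g, hg, hag⟩ := hGcov a ha
    exact ⟨i, hi, g, hg, (lt_div_iff₀' hxj).1 hag⟩

theorem exists_scaled_separated_cover {x : ℕ → ℝ} (hx : Monotone x) (hpos : ∀ n, 0 < x n)
    (hdiv : ¬ Summable fun n => (x n)⁻¹) (r R : ℝ) {δ M : ℝ} (hδ : 0 < δ) (hM : 0 < M) :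
    ∃ (G : ℕ → Finset ℂ) (n₀ : ℕ), (∀ n, ∀ g ∈ G n, r ≤ ‖g‖) ∧
      (∀ n, (G n : Set ℂ).Pairwise fun g g' => M ≤ x n * dist g g') ∧
      (∀ n n', n < n' → ∀ g ∈ G n, ∀ g' ∈ G n', x n * (‖g‖ - ‖g'‖) ≤ M) ∧
      ∀ a, r ≤ ‖a‖ → ‖a‖ ≤ R → ∃ n < n₀, ∃ g ∈ G n, x n * dist a g < δ := by
  obtain ⟨N, hN, ρ, rfl, hρ, hρtop, hwidth, hrings⟩ :=
    exists_rings_separated_cover hx hpos hdiv r hδ hM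
  choose G hGρ hGsep hGcov using hrings
  have hxle : ∀ n, x n ≤ x (N * (n / N + 1)) := fun n => hx (Nat.lt_mul_div_succ n hN).le
  obtain ⟨J, hJ⟩ := (hρtop.eventually_gt_atTop R).exists
  refine ⟨fun n => G (n / N) (n % N), N * J, fun n g hg => ?_, fun n g hg g' hg' hne => ?_,
    fun n n' hn g hg g' hg' => ?_, fun a ha haR => ?_⟩
  · exact (hρ (Nat.zero_le _)).trans (hGρ _ _ g hg).1
  · exact (hGsep _ _ hg hg' hne).trans
      (mul_le_mul_of_nonneg_right (hx (Nat.mul_div_le n N)) dist_nonneg)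
  · have hg := hGρ _ _ g hg
    have hg' := hGρ _ _ g' hg'
    rcases (Nat.div_le_div_right (c := N) hn.le).eq_or_lt with hj | hj
    · rw [← hj] at hg'
      refine (mul_le_mul_of_nonneg (hxle n) ?_ (hpos n).le ?_).trans (hwidth _) <;>
        linarith [hg.1, hg.2, hg'.1]
    · have hle : ‖g‖ ≤ ‖g'‖ := (hg.2.le.trans (hρ (Nat.succ_le_of_lt hj))).trans hg'.1
      exact (mul_nonpos_of_nonneg_of_nonpos (hpos n).le (sub_nonpos.2 hle)).trans hM.le
  · obtain ⟨j, hj⟩ := Set.mem_iUnion.1 ((iUnion_Ico_map_succ_eq_Ici (fun j => hρ (Nat.zero_le j))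
      (not_bddAbove_of_tendsto_atTop hρtop)).ge ha)
    obtain ⟨i, hi, g, hg, hag⟩ := hGcov j a hj
    have hjJ : j < J := hρ.reflect_lt ((hj.1.trans haR).trans_lt hJ)
    have hdivN : (N * j + i) / N = j := by rw [Nat.mul_add_div hN, Nat.div_eq_of_lt hi, add_zero]
    have hmodN : (N * j + i) % N = i := by rw [Nat.mul_add_mod, Nat.mod_eq_of_lt hi]
    refine ⟨N * j + i, ?_, g, by simpa only [hdivN, hmodN] using hg, ?_⟩
    · calc N * j + i < N * (j + 1) := by rw [mul_add_one]; gcongr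
        _ ≤ N * J := Nat.mul_le_mul_left N hjJ
    · have hxj := hxle (N * j + i)
      rw [hdivN] at hxj
      exact (mul_le_mul_of_nonneg_right hxj dist_nonneg).trans_lt hag

theorem le_dist_mul_of_mul_norm_sub_le {x x' g g' : ℂ} {r M : ℝ} (hg' : r ≤ ‖g'‖)
    (hx : ‖x‖ ≤ ‖x'‖) (hgap : 2 * M ≤ r * (‖x'‖ - ‖x‖)) (hM : ‖x‖ * (‖g‖ - ‖g'‖) ≤ M) :
    M ≤ dist (x * g) (x' * g') := by
  have hgap' : r * (‖x'‖ - ‖x‖) ≤ ‖g'‖ * (‖x'‖ - ‖x‖) :=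
    mul_le_mul_of_nonneg_right hg' (sub_nonneg.2 hx)
  have hnorm := norm_sub_norm_le (x' * g') (x * g)
  rw [norm_mul, norm_mul] at hnorm
  rw [dist_comm, dist_eq_norm]
  linarith

theorem pairwise_le_dist_insert_zero_iUnion {E : Type*} [SeminormedAddCommGroup E]
    {F : ℕ → Set E} {M : ℝ} (hnorm : ∀ n, ∀ w ∈ F n, M ≤ ‖w‖)
    (hF : ∀ n, (F n).Pairwise fun w w' => M ≤ dist w w')
    (hlt : ∀ n n', n < n' → ∀ w ∈ F n, ∀ w' ∈ F n', M ≤ dist w w') :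
    (insert 0 (⋃ n, F n)).Pairwise fun w w' => M ≤ dist w w' := by
  have : Std.Symm fun w w' : E => M ≤ dist w w' := ⟨fun w w' h => dist_comm w w' ▸ h⟩
  refine Set.pairwise_insert_of_symm.2 ⟨fun w hw w' hw' hne => ?_, fun w hw _ => ?_⟩
  · obtain ⟨n, hn⟩ := Set.mem_iUnion.1 hw
    obtain ⟨n', hn'⟩ := Set.mem_iUnion.1 hw'
    rcases lt_trichotomy n n' with h | rfl | h
    · exact hlt n n' h w hn w' hn'
    · exact hF n hn hn' hne
    · exact dist_comm w w' ▸ hlt n' n h w' hn' w hn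
  · obtain ⟨n, hn⟩ := Set.mem_iUnion.1 hw
    exact dist_zero_left w ▸ hnorm n w hn

theorem ConditionSigma.exists_gap_subsequence {lam : ℕ → ℂ} (hsig : ConditionSigma lam)
    {C : ℝ} (hC : 0 < C) : ∃ k : ℕ → ℕ, (∀ n, C ≤ ‖lam (k n)‖) ∧
      (∀ n n', n < n' → C ≤ ‖lam (k n')‖ - ‖lam (k n)‖) ∧
      ¬ Summable fun n => ‖lam (k n)‖⁻¹ := by
  obtain ⟨k, -, hgap, hdiv⟩ := hsig C hC
  have hmono : Monotone fun n => ‖lam (k n)‖ :=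
    monotone_nat_of_le_succ fun n => sub_nonneg.1 (hC.trans (hgap n)).le
  have hgap' : ∀ n n', n < n' → C ≤ ‖lam (k n')‖ - ‖lam (k n)‖ := fun n n' hn =>
    (hgap n).le.trans (sub_le_sub_right (hmono (Nat.succ_le_of_lt hn)) _)
  refine ⟨fun n => k (n + 1), fun n => ?_, fun n n' hn => hgap' _ _ (Nat.succ_lt_succ hn), ?_⟩
  · exact (hgap' 0 (n + 1) n.succ_pos).trans (sub_le_self _ (norm_nonneg _))
  · simp only [one_div] at hdiv
    rwa [summable_nat_add_iff 1 (f := fun n => ‖lam (k n)‖⁻¹),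
      not_summable_iff_tendsto_nat_atTop_of_nonneg fun n => inv_nonneg.2 (norm_nonneg _)]

theorem ConditionSigma.exists_separated_net {lam : ℕ → ℂ} (hsig : ConditionSigma lam)
    {r δ M : ℝ} (hr : 0 < r) (R : ℝ) (hδ : 0 < δ) (hM : 0 < M) :
    ∃ W : Finset ℂ, 0 ∉ W ∧ (insert 0 W : Set ℂ).Pairwise (fun w w' => M ≤ dist w w') ∧
      ∀ a : ℂ, r ≤ ‖a‖ → ‖a‖ ≤ R → ∃ n, ∃ w ∈ W, dist (lam n * a) w < δ := by
  classical
  have hC : 0 < 2 * M / r := by positivity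
  obtain ⟨k, hk, hgap, hdiv⟩ := hsig.exists_gap_subsequence hC
  have hmono : Monotone fun n => ‖lam (k n)‖ :=
    monotone_nat_of_le_succ fun n => sub_nonneg.1 (hC.le.trans (hgap _ _ n.lt_succ_self))
  obtain ⟨G, n₀, hGr, hGsep, hGorder, hGcov⟩ :=
    exists_scaled_separated_cover hmono (fun n => hC.trans_le (hk n)) hdiv r R hδ hM
  have hdist : ∀ n g g', dist (lam (k n) * g) (lam (k n) * g') = ‖lam (k n)‖ * dist g g' :=
    fun n g g' => by rw [dist_eq_norm, ← mul_sub, norm_mul, dist_eq_norm]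
  have hnorm : ∀ n, ∀ g ∈ G n, M ≤ ‖lam (k n) * g‖ := fun n g hg => by
    rw [norm_mul]
    calc M ≤ 2 * M / r * r := by rw [div_mul_cancel₀ _ hr.ne']; linarith
      _ ≤ ‖lam (k n)‖ * ‖g‖ := mul_le_mul (hk n) (hGr n g hg) hr.le (norm_nonneg _)
  have hsep := pairwise_le_dist_insert_zero_iUnion (F := fun n => (lam (k n) * ·) '' G n) (M := M)
    (fun n => Set.forall_mem_image.2 (hnorm n))
    (fun n => by
      rintro _ ⟨g, hg, rfl⟩ _ ⟨g', hg', rfl⟩ hne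
      rw [hdist]
      exact hGsep n hg hg' (ne_of_apply_ne _ hne))
    (fun n n' hn => by
      rintro _ ⟨g, hg, rfl⟩ _ ⟨g', hg', rfl⟩
      exact le_dist_mul_of_mul_norm_sub_le (hGr n' g' hg') (hmono hn.le)
        ((div_le_iff₀' hr).1 (hgap n n' hn)) (hGorder n n' hn g hg g' hg'))
  refine ⟨(Finset.range n₀).biUnion fun n => (G n).image (lam (k n) * ·), fun h0 => ?_,
    hsep.mono (Set.insert_subset_insert fun w hw => ?_), fun a har haR => ?_⟩
  · obtain ⟨n, -, g, hg, hw⟩ : ∃ n < n₀, ∃ g ∈ G n, lam (k n) * g = 0 := by simpa using h0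
    exact hM.not_ge (by simpa only [hw, norm_zero] using hnorm n g hg)
  · obtain ⟨n, -, g, hg, rfl⟩ : ∃ n < n₀, ∃ g ∈ G n, lam (k n) * g = w := by simpa using hw
    exact Set.mem_iUnion.2 ⟨n, Set.mem_image_of_mem _ hg⟩
  · obtain ⟨n, hn, g, hg, hag⟩ := hGcov a har haR
    refine ⟨k n, lam (k n) * g, ?_, (hdist n a g).trans_lt hag⟩
    exact Finset.mem_biUnion.2 ⟨n, Finset.mem_range.2 hn, Finset.mem_image_of_mem _ hg⟩

end SeparatedNets

section CommonHypercyclicVectors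

open TopologicalSpace

variable {P X : Type*} [AddCommMonoid X] [Module ℂ X] [TopologicalSpace X]

/-- The vectors whose orbit under each of the sequences `T a`, `a ∈ K`, visits the set `U`. For
compact `K` and open `U` these are the open sets to which Baire's theorem is applied. -/
def visitingVectors (T : P → ℕ → X →L[ℂ] X) (K : Set P) (U : Set X) : Set X :=
  {x | ∀ a ∈ K, ∃ n, T a n x ∈ U}

theorem mem_hypercyclicVectors_iff_countableBasis [SecondCountableTopology X]
    {T : ℕ → X →L[ℂ] X} {x : X} :
    x ∈ hypercyclicVectors T ↔ ∀ U ∈ countableBasis X, ∃ n, T n x ∈ U := by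
  refine (isBasis_countableBasis X).dense_iff.trans (forall₂_congr fun U hU => ?_)
  simp [nonempty_of_mem_countableBasis hU, Set.inter_nonempty]

theorem biInter_hypercyclicVectors_eq [SecondCountableTopology X] (T : P → ℕ → X →L[ℂ] X)
    (K : ℕ → Set P) : ⋂ a ∈ ⋃ k, K k, hypercyclicVectors (T a) =
      ⋂ U ∈ countableBasis X, ⋂ k, visitingVectors T (K k) U := by
  ext x
  simp only [Set.mem_iInter, Set.mem_iUnion, mem_hypercyclicVectors_iff_countableBasis,
    visitingVectors, Set.mem_ofPred_eq]
  exact ⟨fun h U hU k a ha => h a ⟨k, ha⟩ U hU, fun h a ⟨k, ha⟩ U hU => h U hU k a ha⟩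

variable [TopologicalSpace P] {T : P → ℕ → X →L[ℂ] X}

theorem isOpen_visitingVectors (hT : ∀ n, Continuous fun p : X × P => T p.2 n p.1) {K : Set P}
    (hK : IsCompact K) {U : Set X} (hU : IsOpen U) : IsOpen (visitingVectors T K U) := by
  refine isOpen_iff_mem_nhds.2 fun x hx => hK.eventually_forall_of_forall_eventually
    (P := fun x a => ∃ n, T a n x ∈ U) fun a ha => ?_
  obtain ⟨n, hn⟩ := hx a ha
  filter_upwards [(hU.preimage (hT n)).mem_nhds hn] with p hp using ⟨n, hp⟩

theorem isGδ_biInter_hypercyclicVectors [SecondCountableTopology X]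
    (hT : ∀ n, Continuous fun p : X × P => T p.2 n p.1) {S : Set P} (hS : IsSigmaCompact S) :
    IsGδ (⋂ a ∈ S, hypercyclicVectors (T a)) := by
  obtain ⟨K, hK, rfl⟩ := hS
  rw [biInter_hypercyclicVectors_eq]
  exact .biInter (countable_countableBasis X) fun U hU => .iInter_of_isOpen fun k =>
    isOpen_visitingVectors hT (hK k) (isOpen_of_mem_countableBasis hU)

theorem dense_biInter_hypercyclicVectors [SecondCountableTopology X] [BaireSpace X]
    (hT : ∀ n, Continuous fun p : X × P => T p.2 n p.1) {S : Set P} (hS : IsSigmaCompact S)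
    (hdense : ∀ K ⊆ S, IsCompact K → ∀ U, IsOpen U → U.Nonempty → Dense (visitingVectors T K U)) :
    Dense (⋂ a ∈ S, hypercyclicVectors (T a)) := by
  obtain ⟨K, hK, rfl⟩ := hS
  have hopen : ∀ U ∈ countableBasis X, ∀ k, IsOpen (visitingVectors T (K k) U) := fun U hU k =>
    isOpen_visitingVectors hT (hK k) (isOpen_of_mem_countableBasis hU)
  rw [biInter_hypercyclicVectors_eq]
  exact dense_biInter_of_Gδ (fun U hU => .iInter_of_isOpen (hopen U hU))
    (countable_countableBasis X) fun U hU => dense_iInter_of_isOpen (hopen U hU) fun k =>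
      hdense (K k) (Set.subset_iUnion K k) (hK k) U (isOpen_of_mem_countableBasis hU)
        (nonempty_of_mem_countableBasis hU)

end CommonHypercyclicVectors

section Translations

open Metric

theorem EntireSpace.isClosed : IsClosed (EntireSpace : Set C(ℂ, ℂ)) := by
  refine IsSeqClosed.isClosed fun u f hu hf => ?_
  have h := ContinuousMap.tendsto_iff_tendstoLocallyUniformly.1 hf
  rw [← tendstoLocallyUniformlyOn_univ] at h
  exact differentiableOn_univ.1 (h.differentiableOn
    (Eventually.of_forall fun n => (hu n : Differentiable ℂ (u n)).differentiableOn) isOpen_univ)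

instance : BaireSpace EntireSpace := by
  have : CompleteSpace EntireSpace := EntireSpace.isClosed.completeSpace_coe
  have : (uniformity EntireSpace).IsCountablyGenerated := Filter.comap.isCountablyGenerated _ _
  let := UniformSpace.pseudoMetricSpace EntireSpace
  infer_instance

instance : SecondCountableTopology EntireSpace :=
  TopologicalSpace.Subtype.secondCountableTopology _

theorem EntireSpace.exists_forall_near_imp_mem {V : Set EntireSpace} {g : EntireSpace}
    (hV : V ∈ 𝓝 g) : ∃ ρ > 0, ∃ ε > 0, ∀ f : EntireSpace,
      (∀ z ∈ closedBall (0 : ℂ) ρ, ‖f.1 z - g.1 z‖ < ε) → f ∈ V := by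
  obtain ⟨O, hO, hOV⟩ := mem_nhds_subtype _ _ _ |>.1 hV
  obtain ⟨X, hX, hXO⟩ := UniformSpace.mem_nhds_iff.1 hO
  obtain ⟨K, D, hK, hD, hKD⟩ := (ContinuousMap.mem_compactConvergence_entourage_iff X).1 hX
  obtain ⟨ε, hε, hεD⟩ := mem_uniformity_dist.1 hD
  obtain ⟨ρ, hρ, hKρ⟩ := hK.isBounded.subset_closedBall_lt 0 0
  refine ⟨ρ, hρ, ε, hε, fun f hf => hOV (hXO (hKD fun z hz => hεD ?_))⟩
  rw [dist_comm, dist_eq_norm]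
  exact hf z (hKρ hz)

theorem continuous_translationOp_apply :
    Continuous fun p : EntireSpace × ℂ => translationOp p.2 p.1 := by
  refine Continuous.subtype_mk (ContinuousMap.continuous_of_continuous_uncurry _ ?_) _
  change Continuous fun q : (EntireSpace × ℂ) × ℂ => (q.1.1 : C(ℂ, ℂ)) (q.2 + q.1.2)
  fun_prop

theorem translationOp_translationOp (a b : ℂ) (f : EntireSpace) :
    translationOp a (translationOp b f) = translationOp (a + b) f :=
  Subtype.ext (ContinuousMap.ext fun z => congrArg f.1 (add_assoc z a b))

theorem translationOp_zero (f : EntireSpace) : translationOp 0 f = f :=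
  Subtype.ext (ContinuousMap.ext fun z => congrArg f.1 (add_zero z))

theorem exists_nhds_forall_translationOp_mem {U : Set EntireSpace} (hU : IsOpen U)
    {h : EntireSpace} (hh : h ∈ U) :
    ∃ U' ∈ 𝓝 h, ∃ δ > 0, ∀ f ∈ U', ∀ b : ℂ, ‖b‖ < δ → translationOp b f ∈ U := by
  have hnear : (fun p : EntireSpace × ℂ => translationOp p.2 p.1) ⁻¹' U ∈ 𝓝 (h, 0) := by
    refine (hU.preimage continuous_translationOp_apply).mem_nhds ?_
    rwa [Set.mem_preimage, translationOp_zero]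
  obtain ⟨U', hU', B, hB, hUB⟩ := mem_nhds_prod_iff.1 hnear
  obtain ⟨δ, hδ, hδB⟩ := Metric.mem_nhds_iff.1 hB
  exact ⟨U', hU', δ, hδ, fun f hf b hb =>
    hUB (Set.mk_mem_prod hf (hδB (mem_ball_zero_iff.2 hb)))⟩

theorem exists_mem_forall_translationOp_mem_of_separated {U V : Set EntireSpace} (hU : IsOpen U)
    (hUne : U.Nonempty) (hV : IsOpen V) (hVne : V.Nonempty) : ∃ M > 0, ∃ δ > 0,
      ∀ W : Finset ℂ, 0 ∉ W → (insert 0 W : Set ℂ).Pairwise (fun w w' => M ≤ dist w w') →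
        ∃ f ∈ V, ∀ w ∈ W, ∀ b, dist b w < δ → translationOp b f ∈ U := by
  obtain ⟨h, hh⟩ := hUne
  obtain ⟨g, hg⟩ := hVne
  obtain ⟨U', hU', δ, hδ, hU'U⟩ := exists_nhds_forall_translationOp_mem hU hh
  obtain ⟨r₁, hr₁, ε₁, hε₁, hV'⟩ := EntireSpace.exists_forall_near_imp_mem (hV.mem_nhds hg)
  obtain ⟨r₂, -, ε₂, hε₂, hU''⟩ := EntireSpace.exists_forall_near_imp_mem hU'
  have hr : 0 < max r₁ r₂ := hr₁.trans_le (le_max_left _ _)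
  refine ⟨2 * max r₁ r₂ + 1, by positivity, δ, hδ, fun W h0 hW => ?_⟩
  obtain ⟨p, hpg, hph⟩ := exists_polynomial_near_and_near_translates g.2 h.2 hr.le
    (lt_add_one _) (lt_min hε₁ hε₂) h0 hW
  let f : EntireSpace := ⟨p.toContinuousMap, p.differentiable⟩
  refine ⟨f, hV' f fun z hz => ?_, fun w hw b hb => ?_⟩
  · exact (hpg z (closedBall_subset_closedBall (le_max_left _ _) hz)).trans_le (min_le_left _ _)
  · have hfw : translationOp w f ∈ U' := hU'' _ fun z hz =>
      (hph w hw z (closedBall_subset_closedBall (le_max_right _ _) hz)).trans_le (min_le_right _ _)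
    have hbU := hU'U _ hfw (b - w) (by rwa [← dist_eq_norm])
    rwa [translationOp_translationOp, sub_add_cancel] at hbU

theorem exists_forall_norm_mem_Icc_of_isCompact {E : Type*} [NormedAddCommGroup E] {K : Set E}
    (hK : IsCompact K) (h0 : (0 : E) ∉ K) : ∃ r > 0, ∃ R, ∀ a ∈ K, ‖a‖ ∈ Set.Icc r R := by
  obtain ⟨r, hr, hrK⟩ := isOpen_iff.1 hK.isClosed.isOpen_compl 0 h0
  obtain ⟨R, hR⟩ := hK.isBounded.exists_norm_le
  exact ⟨r, hr, R, fun a ha =>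
    ⟨not_lt.1 fun har => hrK (mem_ball_zero_iff.2 har) ha, hR a ha⟩⟩

theorem ConditionSigma.dense_visitingVectors {lam : ℕ → ℂ} (hsig : ConditionSigma lam)
    {K : Set ℂ} (hK : IsCompact K) (h0 : (0 : ℂ) ∉ K) {U : Set EntireSpace} (hU : IsOpen U)
    (hUne : U.Nonempty) :
    Dense (visitingVectors (fun a n => translationOp (lam n * a)) K U) := by
  refine dense_iff_inter_open.2 fun V hV hVne => ?_
  obtain ⟨r, hr, R, hKr⟩ := exists_forall_norm_mem_Icc_of_isCompact hK h0
  obtain ⟨M, hM, δ, hδ, happrox⟩ :=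
    exists_mem_forall_translationOp_mem_of_separated hU hUne hV hVne
  obtain ⟨W, hW0, hW, hnet⟩ := hsig.exists_separated_net hr R hδ hM
  obtain ⟨f, hfV, hfU⟩ := happrox W hW0 hW
  refine ⟨f, hfV, fun a ha => ?_⟩
  obtain ⟨n, w, hw, hnw⟩ := hnet a (hKr a ha).1 (hKr a ha).2
  exact ⟨n, hfU w hw _ hnw⟩

theorem isSigmaCompact_compl_singleton {X : Type*} [TopologicalSpace X] [T1Space X]
    [LocallyCompactSpace X] [SecondCountableTopology X] (x : X) :
    IsSigmaCompact ({x}ᶜ : Set X) := by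
  have : LocallyCompactSpace ({x}ᶜ : Set X) := isOpen_compl_singleton.locallyCompactSpace
  exact isSigmaCompact_iff_sigmaCompactSpace.2 inferInstance

theorem theorem2p1_general (lam : ℕ → ℂ) (hsig : ConditionSigma lam) :
    IsGδ (⋂ a ∈ ({0}ᶜ : Set ℂ), hypercyclicVectors fun n => translationOp (lam n * a)) ∧
    Dense (⋂ a ∈ ({0}ᶜ : Set ℂ), hypercyclicVectors fun n => translationOp (lam n * a)) := by
  have hcont : ∀ n, Continuous fun p : EntireSpace × ℂ => translationOp (lam n * p.2) p.1 :=
    fun n => continuous_translationOp_apply.comp (continuous_fst.prodMk (by fun_prop))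
  have hσ := isSigmaCompact_compl_singleton (0 : ℂ)
  exact ⟨isGδ_biInter_hypercyclicVectors hcont hσ, dense_biInter_hypercyclicVectors hcont hσ
    fun K hK0 hK U hU hUne => hsig.dense_visitingVectors hK (fun h0 => hK0 h0 rfl) hU hUne⟩

end Translations

theorem theorem2p1 (lam : ℕ → ℂ) (hne : ∀ n, lam n ≠ 0)
    (hlim : Tendsto (fun n => ‖lam n‖) atTop atTop) (hsig : ConditionSigma lam) :
    IsGδ (⋂ a ∈ ({0}ᶜ : Set ℂ), hypercyclicVectors fun n => translationOp (lam n * a)) ∧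
    Dense (⋂ a ∈ ({0}ᶜ : Set ℂ), hypercyclicVectors fun n => translationOp (lam n * a)) :=
  theorem2p1_general lam hsig
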